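/- Let $U\subset\mathbb{C}$ be a domain (a non-empty connected open set) and let $\Psi\in L^1_{loc}(U)$ be a real-valued piecewise harmonic function with its canonical decomposition: there are finitely many pairwise distinct real-valued harmonic functions $H_1,\dots,H_r$ in $U$ such that $\Gamma:=U\cap\bigcap_{i=1}^r \operatorname{supp}(\Psi-H_i)$ has Lebesgue measure $0$, where supports are taken in the sense of distributions on $U$. Let $M_i:=U\setminus\operatorname{supp}(\Psi-H_i)$ be the largest open subset of $U$ on which $\Psi=H_i$ almost everywhere, and let $\chi_i$ be the characteristic function of $M_i$, so that $\Psi=\sum_{i=1}^r H_i\chi_i$ a.e. in $U$. If $\Psi$ is continuous, i.e. agrees almost everywhere in $U$ with a continuous function on $U$, then, in the sense of distributions on $U$, $$\frac{\partial\Psi}{\partial z}=\sum_{i=1}^r A_i\chi_i,\qquad A_i:=\frac{\partial H_i}{\partial z}=\frac12\left(\frac{\partial H_i}{\partial x}-i\,\frac{\partial H_i}{\partial y}\right).$$ In particular, $\partial\Psi/\partial z$ is piecewise analytic: it is given by a function $\Phi\in L^1_{loc}(U)$, namely $\Phi=\sum_{i=1}^r A_i\chi_i$, for which there are finitely many pairwise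 distinct analytic functions $B_1,\dots,B_s$ in $U$ such that $U\cap\bigcap_{k=1}^s\operatorname{supp}(\Phi-B_k)$ has Lebesgue measure $0$. -/

import Mathlib

open scoped Distributions LineDeriv

noncomputable section

namespace PiecewiseHarmonic

open MeasureTheory TopologicalSpace

/-- The distribution `u ↦ ∫ u f` on the open set `U` defined by a locally integrable function `f`
on `U`. (If `f` is not locally integrable on `U`, this is the zero distribution.) -/
def regularDistribution (U : Opens ℂ) {F : Type*} [NormedAddCommGroup F] [NormedSpace ℝ F]
    (f : ℂ → F) : 𝓓'(U, F) :=
  (TestFunction.integralAgainstBilinCLM (ContinuousLinearMap.lsmul ℝ ℝ) volume f :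
    𝓓(U, ℝ) →L[ℝ] F)

/-- The support in `U` of (the distribution defined by) a locally integrable function `f` on `U`:
the complement in `U` of the largest open subset of `U` on which that distribution vanishes. -/
def distSupport (U : Opens ℂ) {F : Type*} [NormedAddCommGroup F] [NormedSpace ℝ F]
    (f : ℂ → F) : Set ℂ :=
  (U : Set ℂ) ∩ Distribution.dsupport (regularDistribution U f)

/-- The canonical piece `M = U \ supp (φ - ψ)`: the largest open subset of `U` on which `φ` and `ψ`
define the same distribution. -/
def canonicalPiece (U : Opens ℂ) {F : Type*} [NormedAddCommGroup F] [NormedSpace ℝ F]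
    (φ ψ : ℂ → F) : Set ℂ :=
  (U : Set ℂ) \ distSupport U (fun z => φ z - ψ z)

/-- `φ` is a locally integrable function on `U` with canonical piecewise decomposition given by the
pairwise distinct functions `φ_ 0, …, φ_ (r - 1)` on `U` in the class `X`: the set
`Γ = ⋂ i, supp (φ - φ_ i)`, i.e. the complement in `U` of the union of the canonical pieces, is
Lebesgue negligible. Elements of `X` are functions on `U`, represented by arbitrary extensions
to `ℂ`. -/
structure IsCanonicalDecomposition (U : Opens ℂ) {F : Type*} [NormedAddCommGroup F]
    [NormedSpace ℝ F] (X : Set (ℂ → F)) (φ : ℂ → F) {r : ℕ} (φ_ : Fin r → ℂ → F) : Prop where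
  locallyIntegrableOn : LocallyIntegrableOn φ U volume
  mem : ∀ i, φ_ i ∈ X
  distinct : ∀ i j, i ≠ j → ¬ Set.EqOn (φ_ i) (φ_ j) U
  negligible : volume ((U : Set ℂ) ∩ ⋂ i, distSupport U (fun z => φ z - φ_ i z)) = 0

/-- `φ` is piecewise in `X`. -/
def IsPiecewiseIn (U : Opens ℂ) {F : Type*} [NormedAddCommGroup F] [NormedSpace ℝ F]
    (X : Set (ℂ → F)) (φ : ℂ → F) : Prop :=
  ∃ (r : ℕ) (φ_ : Fin r → ℂ → F), IsCanonicalDecomposition U X φ φ_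

/-- The real-valued harmonic functions in `U`. -/
def harmonicFunctions (U : Opens ℂ) : Set (ℂ → ℝ) :=
  {h | InnerProductSpace.HarmonicOnNhd h U}

/-- The (complex) analytic functions in `U`. -/
def analyticFunctions (U : Opens ℂ) : Set (ℂ → ℂ) :=
  {a | AnalyticOnNhd ℂ a U}

/-- A function is continuous in `U` if it agrees almost everywhere in `U` with a continuous function
on `U`. -/
def IsContinuousIn (U : Opens ℂ) (φ : ℂ → ℝ) : Prop :=
  ∃ c : ℂ → ℝ, ContinuousOn c U ∧ φ =ᵐ[volume.restrict (U : Set ℂ)] c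

/-- The classical Wirtinger derivative `∂h/∂z = (∂h/∂x - i ∂h/∂y) / 2` of a real-valued function. -/
def dz (h : ℂ → ℝ) (z : ℂ) : ℂ :=
  (1 / 2 : ℂ) * ((fderiv ℝ h z 1 : ℂ) - Complex.I * (fderiv ℝ h z Complex.I : ℂ))

/-- The derivative `∂T/∂z = (∂T/∂x - i ∂T/∂y) / 2` of a complex-valued distribution on `U`. -/
def distDz {U : Opens ℂ} (T : 𝓓'(U, ℂ)) : 𝓓'(U, ℂ) :=
  (1 / 2 : ℂ) • (∂_{(1 : ℂ)} T - Complex.I • ∂_{Complex.I} T)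

end PiecewiseHarmonic

end

/-! Let `c` be the continuous representative of Ψ. It equals `H i` on the i-th canonical piece, and
the pieces fill U up to the null set Γ; by continuity each value of `c`, even on Γ, is a value of
some `H i`. For a test function `u`, the product `u * c` is then a continuous selection from the
finitely many Lipschitz functions `u * H i`, hence Lipschitz
(`lipschitzWith_of_continuous_selection`). Directional derivatives of a compactly supported
Lipschitz function integrate to zero, and almost everywhere they are given by the product rule on
the pieces. So integration by parts leaves no term on Γ, whose geometry never enters
(`integral_lineDeriv_mul_eq_neg_of_piecewise`). Piecewise analyticity follows since each A_i is
analytic; coinciding A_i have to be merged (`isPiecewiseIn_of_eqOn`). -/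

namespace PiecewiseHarmonic

section Auxiliary

open MeasureTheory Filter Topology Set
open scoped NNReal ContDiff

/-! ### Continuous selections of Lipschitz functions -/

section Selection

/-- One-dimensional one-sided version of `lipschitzWith_of_continuous_selection`. -/
theorem le_add_mul_of_continuous_selection {ι : Type*} [Finite ι] {f : ℝ → ℝ} (hf : Continuous f)
    {h : ι → ℝ → ℝ} {C : ℝ≥0} (hh : ∀ i, LipschitzWith C (h i)) (hsel : ∀ x, ∃ i, f x = h i x)
    {a b : ℝ} (hab : a ≤ b) : f b ≤ f a + C * (b - a) := by
  refine image_le_of_liminf_slope_right_le_deriv_boundary (f := f) (a := a) (b := b)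
    (B := fun t => f a + C * (t - a)) (B' := fun _ => (C : ℝ)) hf.continuousOn (by simp)
    (by fun_prop) (fun x _ => ?_) (fun x _ r hr => ?_) (right_mem_Icc.2 hab)
  · simpa using! (((hasDerivAt_id x).sub_const a).const_mul (C : ℝ)).const_add (f a)
      |>.hasDerivWithinAt
  -- Pigeonhole: one index recurs at points decreasing to `x`. A liminf bound on slopes needs no
  -- more than these points.
  · obtain ⟨i, hi⟩ : ∃ i, ∃ᶠ z in 𝓝[>] x, f z = h i z := by
      by_contra! H
      obtain ⟨z, hz⟩ := (eventually_all.2 fun i => H i).exists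
      obtain ⟨i, hi⟩ := hsel z
      exact hz i hi
    have hx : f x = h i x :=
      show x ∈ {z | f z = h i z} from
        (isClosed_eq hf (hh i).continuous).mem_of_frequently_of_tendsto hi
          (tendsto_id.mono_left nhdsWithin_le_nhds)
    refine (hi.and_eventually self_mem_nhdsWithin).mono fun z hz => ?_
    have hxz : 0 < z - x := sub_pos.2 hz.2
    rw [slope_def_field, hz.1, hx]
    refine lt_of_le_of_lt ((div_le_iff₀ hxz).2 ?_) hr
    have := (hh i).dist_le_mul z x
    rw [Real.dist_eq, Real.dist_eq, abs_of_pos hxz] at this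
    exact (le_abs_self _).trans this

/-- A continuous function which at each point agrees with one of finitely many `C`-Lipschitz
functions is `C`-Lipschitz. -/
theorem lipschitzWith_of_continuous_selection {E ι : Type*} [NormedAddCommGroup E]
    [NormedSpace ℝ E] [Finite ι] {f : E → ℝ} (hf : Continuous f) {h : ι → E → ℝ} {C : ℝ≥0}
    (hh : ∀ i, LipschitzWith C (h i)) (hsel : ∀ x, ∃ i, f x = h i x) : LipschitzWith C f := by
  refine LipschitzWith.of_le_add_mul C fun y x => ?_
  -- Restricting to the segment from `x` to `y` reduces to one variable.
  have hl : LipschitzWith ‖y - x‖₊ (fun t : ℝ => x + t • (y - x)) := by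
    refine LipschitzWith.of_dist_le_mul fun s t => ?_
    rw [dist_add_left, dist_eq_norm, ← sub_smul, norm_smul, mul_comm, coe_nnnorm, dist_eq_norm]
  have := le_add_mul_of_continuous_selection (f := fun t : ℝ => f (x + t • (y - x)))
    (hf.comp hl.continuous) (fun i => (hh i).comp hl) (fun t => hsel _) zero_le_one
  simpa [dist_eq_norm] using this

end Selection

/-! ### Products with compactly supported functions and sums over pieces -/

section CompactSupport

variable {E : Type*} [NormedAddCommGroup E] [NormedSpace ℝ E]

theorem contDiff_mul_of_tsupport_subset {n : ℕ∞ω} {u h : E → ℝ} {s : Set E} (hu : ContDiff ℝ n u)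
    (hus : tsupport u ⊆ s) (hh : ∀ x ∈ s, ContDiffAt ℝ n h x) :
    ContDiff ℝ n (fun x => u x * h x) := by
  refine contDiff_iff_contDiffAt.2 fun x => ?_
  by_cases hx : x ∈ tsupport u
  · exact hu.contDiffAt.mul (hh x (hus hx))
  · refine (contDiffAt_const (c := (0 : ℝ))).congr_of_eventuallyEq ?_
    filter_upwards [notMem_tsupport_iff_eventuallyEq.1 hx] with y hy
    simp [hy]

end CompactSupport

theorem continuous_mul_of_tsupport_subset {E : Type*} [TopologicalSpace E] {u c : E → ℝ}
    {s : Set E} (hs : IsOpen s)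
    (hu : Continuous u) (hus : tsupport u ⊆ s) (hc : ContinuousOn c s) :
    Continuous (fun x => u x * c x) := by
  refine continuous_of_tsupport fun x hx => ?_
  exact hu.continuousAt.mul (hc.continuousAt (hs.mem_nhds (hus (tsupport_mul_subset_left hx))))

theorem integrable_smul_of_tsupport_subset {E F : Type*} [TopologicalSpace E] [T2Space E]
    [MeasurableSpace E] [BorelSpace E] [TopologicalSpace.PseudoMetrizableSpace E] [NormedAddCommGroup F]
    [NormedSpace ℝ F] {μ : Measure E} {u : E → ℝ} {G : E → F} {s : Set E} (hu : Continuous u)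
    (huc : HasCompactSupport u) (hus : tsupport u ⊆ s) (hG : LocallyIntegrableOn G s μ) :
    Integrable (fun x => u x • G x) μ := by
  refine (integrableOn_iff_integrable_of_support_subset (s := tsupport u) fun x hx => ?_).1
    ((hG.integrableOn_compact_subset hus huc).continuousOn_smul hu.continuousOn huc)
  exact subset_tsupport u fun h => hx (by simp [h])

theorem sum_indicator_eq_of_mem {ι X F : Type*} [Fintype ι] [AddCommMonoid F] {M : ι → Set X}
    (hM : Pairwise fun i j => Disjoint (M i) (M j)) (g : ι → X → F) {i : ι} {x : X}
    (hx : x ∈ M i) : ∑ j, (M j).indicator (g j) x = g i x := by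
  rw [Finset.sum_eq_single i (fun j _ hj => indicator_of_notMem
    (fun hxj => (hM hj).le_bot ⟨hxj, hx⟩) _) (by simp), indicator_of_mem hx]

theorem locallyIntegrableOn_sum_indicator {ι X F : Type*} [Fintype ι] [TopologicalSpace X]
    [MeasurableSpace X] [OpensMeasurableSpace X] [SecondCountableTopology X]
    [NormedAddCommGroup F] {μ : Measure X} [IsLocallyFiniteMeasure μ]
    {U : Set X} (hU : MeasurableSet U) {M : ι → Set X} (hM : ∀ i, MeasurableSet (M i))
    {g : ι → X → F} (hg : ∀ i, ContinuousOn (g i) U) :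
    LocallyIntegrableOn (fun x => ∑ i, (M i).indicator (g i) x) U μ := by
  have key : ∀ s : Finset ι,
      LocallyIntegrableOn (fun x => ∑ i ∈ s, (M i).indicator (g i) x) U μ := by
    classical
    intro s
    induction s using Finset.induction_on with
    | empty => simpa using locallyIntegrableOn_zero
    | insert i s hi ih =>
      simp only [Finset.sum_insert hi]
      refine LocallyIntegrableOn.add (fun x hx => ?_) ih
      obtain ⟨t, ht, hgt⟩ := (hg i).locallyIntegrableOn (μ := μ) hU x hx
      exact ⟨t, ht, hgt.indicator (hM i)⟩
  exact key Finset.univ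

/-- Each value of a continuous function that agrees with one of finitely many continuous functions
off a null set is a value of one of these functions. -/
theorem exists_eq_of_measure_diff_iUnion_eq_zero {E ι : Type*} [TopologicalSpace E] [MeasurableSpace E]
    {μ : Measure E} [μ.IsOpenPosMeasure] [Finite ι] {U : Set E} (hU : IsOpen U)
    {M : ι → Set E} {H : ι → E → ℝ} {c : E → ℝ} (hc : ContinuousOn c U)
    (hH : ∀ i, ContinuousOn (H i) U) (hcH : ∀ i, EqOn c (H i) (M i))
    (hnull : μ (U \ ⋃ i, M i) = 0) {x : E} (hx : x ∈ U) : ∃ i, c x = H i x := by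
  by_contra! hne
  have hUx := hU.mem_nhds hx
  have hev : ∀ᶠ y in 𝓝 x, ∀ i, c y ≠ H i y := eventually_all.2 fun i =>
    ((hc.continuousAt hUx).ne_iff_eventually_ne ((hH i).continuousAt hUx)).1 (hne i)
  -- A value missed by all `H i` is missed nearby too, so a whole neighbourhood would lie in the
  -- null set.
  have hmem : U \ ⋃ i, M i ∈ 𝓝 x := by
    filter_upwards [hev, hUx] with y hy hyU
    refine ⟨hyU, fun hyM => ?_⟩
    obtain ⟨i, hi⟩ := mem_iUnion.1 hyM
    exact hy i (hcH i hi)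
  exact (Measure.measure_pos_of_mem_nhds μ hmem).ne' hnull

/-! ### Integration by parts across the pieces -/

section IntegrationByParts

variable {E ι : Type*} [NormedAddCommGroup E] [NormedSpace ℝ E] [FiniteDimensional ℝ E]
  [MeasurableSpace E] [BorelSpace E] {μ : Measure E} [μ.IsAddHaarMeasure]

/-- Integrate by parts against the constant 1; taking `-v` cancels the sign in that formula. -/
theorem integral_lineDeriv_eq_zero {f : E → ℝ} {C : ℝ≥0} (hf : LipschitzWith C f)
    (hfc : HasCompactSupport f) (v : E) : ∫ x, lineDeriv ℝ f x v ∂μ = 0 := by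
  have h := LipschitzWith.integral_lineDeriv_mul_eq (μ := μ)
    (LipschitzWith.const (1 : ℝ) : LipschitzWith 0 fun _ : E => (1 : ℝ)) hf hfc (-v)
  simpa [lineDeriv] using h.symm

/-- Integration by parts for a continuous, piecewise continuously differentiable function whose
finitely many pieces are restrictions of functions on the whole of `U` and fill `U` up to a null
set. -/
theorem integral_lineDeriv_mul_eq_neg_of_piecewise [Fintype ι] [Nonempty ι] {U : Set E}
    (hU : IsOpen U) {M : ι → Set E} (hM : ∀ i, IsOpen (M i))
    (hdisj : Pairwise fun i j => Disjoint (M i) (M j)) {H : ι → E → ℝ} {c : E → ℝ}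
    (hc : ContinuousOn c U) (hH : ∀ i, ∀ x ∈ U, ContDiffAt ℝ 1 (H i) x)
    (hcH : ∀ i, EqOn c (H i) (M i)) (hnull : μ (U \ ⋃ i, M i) = 0)
    {u : E → ℝ} (hu : ContDiff ℝ 1 u) (huc : HasCompactSupport u) (huU : tsupport u ⊆ U) (v : E) :
    ∫ x, lineDeriv ℝ u x v * c x ∂μ =
      -∫ x, u x * ∑ i, (M i).indicator (fun y => fderiv ℝ (H i) y v) x ∂μ := by
  set G : E → ℝ := fun x => ∑ i, (M i).indicator (fun y => fderiv ℝ (H i) y v) x with hG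
  have hud : Differentiable ℝ u := hu.differentiable one_ne_zero
  have hLip : ∀ i, ∃ C, LipschitzWith C (fun x => u x * H i x) := fun i =>
    ContDiff.lipschitzWith_of_hasCompactSupport (huc.mul_right)
      (contDiff_mul_of_tsupport_subset hu huU (hH i)) one_ne_zero
  choose C hC using hLip
  have hsel : ∀ x, ∃ i, u x * c x = u x * H i x := fun x => by
    by_cases hx : x ∈ U
    · obtain ⟨i, hi⟩ := exists_eq_of_measure_diff_iUnion_eq_zero (μ := μ) hU hc
        (fun i x hx => (hH i x hx).continuousAt.continuousWithinAt) hcH hnull hx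
      exact ⟨i, by rw [hi]⟩
    · exact ⟨Classical.arbitrary ι,
        by simp [image_eq_zero_of_notMem_tsupport fun h => hx (huU h)]⟩
  have hF : LipschitzWith (∑ i, C i) (fun x => u x * c x) :=
    lipschitzWith_of_continuous_selection
      (continuous_mul_of_tsupport_subset hU hu.continuous huU hc)
      (fun i => (hC i).weaken (Finset.single_le_sum (fun _ _ => zero_le) (Finset.mem_univ i)))
      hsel
  have hae : ∀ᵐ x ∂μ, lineDeriv ℝ (fun y => u y * c y) x v
      = lineDeriv ℝ u x v * c x + u x * G x := by
    filter_upwards [measure_eq_zero_iff_ae_notMem.1 hnull] with x hx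
    by_cases hxU : x ∈ U
    · obtain ⟨i, hi⟩ := mem_iUnion.1 (not_not.1 fun h => hx ⟨hxU, h⟩)
      have hHd : DifferentiableAt ℝ (H i) x := (hH i x hxU).differentiableAt one_ne_zero
      -- The pieces are open, so near `x` the product is differentiable in the classical sense.
      have heq : (fun y => u y * c y) =ᶠ[𝓝 x] fun y => u y * H i y := by
        filter_upwards [(hM i).mem_nhds hi] with y hy
        rw [hcH i hy]
      rw [heq.lineDeriv_eq, ((hud x).fun_mul hHd).lineDeriv_eq_fderiv, fderiv_fun_mul (hud x) hHd,
        (hud x).lineDeriv_eq_fderiv, hcH i hi, hG]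
      simp only [sum_indicator_eq_of_mem hdisj _ hi]
      simp
      ring
    · have hz : u =ᶠ[𝓝 x] 0 := notMem_tsupport_iff_eventuallyEq.1 fun h => hxU (huU h)
      have hz' : (fun y => u y * c y) =ᶠ[𝓝 x] 0 := hz.mono fun y hy => by simp [hy]
      rw [hz'.lineDeriv_eq, hz.lineDeriv_eq, hz.eq_of_nhds]
      simp [lineDeriv]
  have hsup : tsupport (fun x => fderiv ℝ u x v) ⊆ tsupport u :=
    (closure_mono (Function.support_subset_iff'.2 fun x hx => by
      rw [Function.notMem_support.1 hx, zero_apply])).trans (tsupport_fderiv_subset ℝ)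
  have hcont : Continuous fun x => fderiv ℝ u x v :=
    (hu.continuous_fderiv one_ne_zero).clm_apply continuous_const
  have hi1 : Integrable (fun x => lineDeriv ℝ u x v * c x) μ := by
    simp only [(hud _).lineDeriv_eq_fderiv]
    exact integrable_smul_of_tsupport_subset hcont
      (huc.mono' (subset_closure.trans hsup)) (hsup.trans huU)
      (hc.locallyIntegrableOn hU.measurableSet)
  have hi2 : Integrable (fun x => u x * G x) μ :=
    integrable_smul_of_tsupport_subset hu.continuous huc huU
      (locallyIntegrableOn_sum_indicator hU.measurableSet (fun i => (hM i).measurableSet)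
        fun i x hx => (((hH i x hx).fderiv_right (m := 0) le_rfl).continuousAt.clm_apply
          continuousAt_const).continuousWithinAt)
  have h0 := integral_lineDeriv_eq_zero (μ := μ) hF huc.mul_right v
  rw [integral_congr_ae hae, integral_add hi1 hi2] at h0
  linarith

end IntegrationByParts

/-! ### Distributional supports and canonical pieces -/

section Distributions

open TopologicalSpace

variable {U : Opens ℂ} {F : Type*} [NormedAddCommGroup F] [NormedSpace ℝ F] {f φ ψ : ℂ → F}

theorem regularDistribution_apply (hf : LocallyIntegrableOn f U volume) (u : 𝓓(U, ℝ)) :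
    regularDistribution U f u = ∫ z, u z • f z :=
  TestFunction.integralAgainstBilinCLM_eq_integral hf

theorem regularDistribution_apply_of_not (hf : ¬ LocallyIntegrableOn f U volume) (u : 𝓓(U, ℝ)) :
    regularDistribution U f u = 0 :=
  DFunLike.congr_fun (TestFunction.integralAgainstBilinCLM_eq_zero hf) u

theorem isOpen_canonicalPiece : IsOpen (canonicalPiece U φ ψ) := by
  rw [canonicalPiece, distSupport, sdiff_self_inter]
  exact U.isOpen.sdiff Distribution.isClosed_dsupport

theorem canonicalPiece_subset : canonicalPiece U φ ψ ⊆ U := sdiff_subset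

theorem mem_canonicalPiece_iff {z : ℂ} : z ∈ canonicalPiece U φ ψ ↔
    z ∈ U ∧ z ∉ distSupport U (fun w => φ w - ψ w) := Iff.rfl

/-- The canonical pieces cover `U` up to the set in the definition of a canonical decomposition. -/
theorem diff_iUnion_canonicalPiece {ι : Type*} (ψ_ : ι → ℂ → F) :
    (U : Set ℂ) \ ⋃ i, canonicalPiece U φ (ψ_ i) =
      (U : Set ℂ) ∩ ⋂ i, distSupport U (fun z => φ z - ψ_ i z) := by
  ext z
  simp only [Set.mem_sdiff, mem_iUnion, mem_canonicalPiece_iff, mem_inter_iff, mem_iInter, not_exists,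
    SetLike.mem_coe, not_and, not_not]
  exact ⟨fun h => ⟨h.1, fun i => h.2 i h.1⟩, fun h => ⟨h.1, fun i _ => h.2 i⟩⟩

/-- The fundamental lemma of the calculus of variations. -/
theorem exists_isOpen_ae_eq_zero_of_notMem_distSupport [CompleteSpace F]
    (hf : LocallyIntegrableOn f U volume) {z : ℂ} (hz : z ∈ U) (hzf : z ∉ distSupport U f) :
    ∃ V : Set ℂ, IsOpen V ∧ z ∈ V ∧ V ⊆ U ∧ ∀ᵐ w, w ∈ V → f w = 0 := by
  obtain ⟨s, hs, hso, hzs⟩ := (Distribution.notMem_dsupport_iff z).1 fun h => hzf ⟨hz, h⟩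
  refine ⟨s ∩ U, hso.inter U.isOpen, ⟨hzs, hz⟩, inter_subset_right, ?_⟩
  refine (hso.inter U.isOpen).ae_eq_zero_of_integral_contDiff_smul_eq_zero
    (hf.mono_set inter_subset_right) fun g hg hgc hgs => ?_
  rw [← hs ⟨g, hg, hgc, hgs.trans inter_subset_right⟩ (hgs.trans inter_subset_left),
    regularDistribution_apply hf]
  rfl

theorem notMem_distSupport_of_ae_eq_zero {V : Set ℂ} (hV : IsOpen V) {z : ℂ} (hz : z ∈ V)
    (hf : ∀ᵐ w, w ∈ V → f w = 0) : z ∉ distSupport U f := by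
  refine fun h => (Distribution.notMem_dsupport_iff z).2 ⟨V, fun u hu => ?_, hV, hz⟩ h.2
  by_cases hfi : LocallyIntegrableOn f U volume
  · rw [regularDistribution_apply hfi]
    refine integral_eq_zero_of_ae (hf.mono fun w hw => ?_)
    by_cases hwV : w ∈ V
    · simp [hw hwV]
    · simp [image_eq_zero_of_notMem_tsupport fun h => hwV (hu h)]
  · exact regularDistribution_apply_of_not hfi u

/-- On a canonical piece, two functions that are continuous up to modification on a null set
agree. -/
theorem eqOn_canonicalPiece [CompleteSpace F] {c : ℂ → F} (hφ : LocallyIntegrableOn φ U volume)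
    (hc : ContinuousOn c U) (hφc : φ =ᵐ[volume.restrict (U : Set ℂ)] c)
    (hψ : ContinuousOn ψ U) : EqOn c ψ (canonicalPiece U φ ψ) := by
  intro z hz
  obtain ⟨V, hV, hzV, hVU, hae⟩ := exists_isOpen_ae_eq_zero_of_notMem_distSupport
    (hφ.sub (hψ.locallyIntegrableOn U.isOpen.measurableSet)) hz.1 hz.2
  refine Measure.eqOn_open_of_ae_eq (μ := volume) ?_ hV (hc.mono hVU) (hψ.mono hVU) hzV
  filter_upwards [ae_restrict_of_ae_restrict_of_subset hVU hφc, ae_restrict_of_ae hae,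
    ae_restrict_mem hV.measurableSet] with w h1 h2 h3
  rw [← h1, ← sub_eq_zero]
  exact h2 h3

end Distributions

/-! ### Harmonic pieces and their Wirtinger derivatives -/

section Harmonic

open InnerProductSpace TopologicalSpace

variable {U : Opens ℂ}

theorem contDiffAt_of_mem_harmonicFunctions {h : ℂ → ℝ} (hh : h ∈ harmonicFunctions U) {z : ℂ}
    (hz : z ∈ U) : ContDiffAt ℝ 1 h z :=
  (hh z hz).1.of_le one_le_two

theorem analyticOnNhd_dz {h : ℂ → ℝ} (hh : h ∈ harmonicFunctions U) :
    dz h ∈ analyticFunctions U := fun z hz =>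
  analyticAt_const.mul (HarmonicAt.analyticAt_complex_partial (hh z hz))

/-- On an overlap, which is open, `H i = c = H j`; the identity theorem for real-analytic functions
spreads this over the connected set U. -/
theorem pairwise_disjoint_canonicalPiece (hU : IsConnected (U : Set ℂ)) {c φ : ℂ → ℝ}
    {ι : Type*} {H : ι → ℂ → ℝ} (hH : ∀ i, H i ∈ harmonicFunctions U)
    (hdist : ∀ i j, i ≠ j → ¬ EqOn (H i) (H j) U)
    (hc : ∀ i, EqOn c (H i) (canonicalPiece U φ (H i))) :
    Pairwise fun i j => Disjoint (canonicalPiece U φ (H i)) (canonicalPiece U φ (H j)) := by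
  refine fun i j hij => Set.disjoint_left.2 fun z hi hj => hdist i j hij ?_
  refine AnalyticOnNhd.eqOn_of_preconnected_of_eventuallyEq (𝕜 := ℝ)
    (fun w hw => HarmonicAt.analyticAt (hH i w hw)) (fun w hw => HarmonicAt.analyticAt (hH j w hw))
    hU.isPreconnected hi.1 ?_
  filter_upwards [isOpen_canonicalPiece.mem_nhds hi, isOpen_canonicalPiece.mem_nhds hj]
    with w hwi hwj
  rw [← hc i hwi, hc j hwj]

/-- A function equal to a function `A i` in `X` on each of finitely many open sets that fill `U` up
to a null set is piecewise in `X`. The functions `A i` may coincide on `U`. -/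
theorem isPiecewiseIn_of_eqOn {ι : Type*} [Finite ι] {F : Type*} [NormedAddCommGroup F]
    [NormedSpace ℝ F] {X : Set (ℂ → F)}
    (hX : ∀ a ∈ X, (U : Set ℂ).indicator a ∈ X) {Φ : ℂ → F} (hΦ : LocallyIntegrableOn Φ U volume)
    {A : ι → ℂ → F} (hA : ∀ i, A i ∈ X) {M : ι → Set ℂ} (hM : ∀ i, IsOpen (M i))
    (hMU : ∀ i, M i ⊆ U) (hΦA : ∀ i, EqOn Φ (A i) (M i))
    (hnull : volume ((U : Set ℂ) \ ⋃ i, M i) = 0) : IsPiecewiseIn U X Φ := by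
  -- Extension by zero turns equality on U into equality of functions, so enumerating the range
  -- removes duplicates.
  obtain ⟨s, ⟨e⟩⟩ := Finite.exists_equiv_fin (Set.range fun i => (U : Set ℂ).indicator (A i))
  refine ⟨s, fun k => (e.symm k : ℂ → F), hΦ, fun k => ?_, fun k l hkl hEq => hkl ?_, ?_⟩
  · obtain ⟨i, hi⟩ := (e.symm k).2
    rw [← hi]
    exact hX _ (hA i)
  · obtain ⟨i, hi⟩ := (e.symm k).2
    obtain ⟨j, hj⟩ := (e.symm l).2
    refine e.symm.injective (Subtype.ext ?_)
    rw [← hi, ← hj] at hEq ⊢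
    funext z
    by_cases hz : z ∈ (U : Set ℂ)
    · exact hEq hz
    · simp [hz]
  · refine measure_mono_null ?_ hnull
    refine fun z hz => ⟨hz.1, fun hzM => ?_⟩
    obtain ⟨i, hi⟩ := mem_iUnion.1 hzM
    have hzi := mem_iInter.1 hz.2 (e ⟨(U : Set ℂ).indicator (A i), mem_range_self i⟩)
    refine notMem_distSupport_of_ae_eq_zero (hM i) hi (Eventually.of_forall fun w hw => ?_) hzi
    simp [hΦA i hw, hMU i hw]

theorem indicator_mem_analyticFunctions {a : ℂ → ℂ} (ha : a ∈ analyticFunctions U) :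
    (U : Set ℂ).indicator a ∈ analyticFunctions U := fun z hz =>
  (ha z hz).congr <| by
    filter_upwards [U.isOpen.mem_nhds hz] with w hw
    rw [indicator_of_mem hw]

theorem lineDerivOp_regularDistribution_ofReal {Ψ c : ℂ → ℝ}
    (hΨ : LocallyIntegrableOn Ψ U volume) (hΨc : Ψ =ᵐ[volume.restrict (U : Set ℂ)] c)
    (u : 𝓓(U, ℝ)) (v : ℂ) :
    (∂_{v} (regularDistribution U fun z => (Ψ z : ℂ))) u =
      -((∫ z, lineDeriv ℝ u z v * c z : ℝ) : ℂ) := by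
  have hΨ' : LocallyIntegrableOn (fun z => (Ψ z : ℂ)) U volume := fun z hz => by
    obtain ⟨t, ht, hti⟩ := hΨ z hz
    exact ⟨t, ht, hti.ofReal⟩
  rw [Distribution.lineDerivOp_apply_apply, map_neg, regularDistribution_apply hΨ',
    ← integral_complex_ofReal]
  congr 1
  refine integral_congr_ae ?_
  filter_upwards [(ae_restrict_iff' U.isOpen.measurableSet).1 hΨc] with z hz
  have hd : (∂_{v} u : 𝓓(U, ℝ)) z = lineDeriv ℝ u z v := by
    rw [TestFunction.lineDerivOp_eq_lineDerivCLM ℝ, TestFunction.lineDerivCLM_apply_of_le (by simp)]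
  by_cases hzU : z ∈ U
  · rw [hz hzU, hd]
    simp
  · have h0 : (∂_{v} u : 𝓓(U, ℝ)) z = 0 :=
      image_eq_zero_of_notMem_tsupport fun h => hzU ((∂_{v} u : 𝓓(U, ℝ)).tsupport_subset h)
    rw [← hd, h0]
    simp

end Harmonic

end Auxiliary

end PiecewiseHarmonic

open PiecewiseHarmonic in
theorem mainTheorem8 (U : TopologicalSpace.Opens ℂ) (hU : IsConnected (U : Set ℂ))
    (Ψ : ℂ → ℝ) (r : ℕ) (H : Fin r → ℂ → ℝ)
    (hΨ : PiecewiseHarmonic.IsCanonicalDecomposition U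
      (PiecewiseHarmonic.harmonicFunctions U) Ψ H)
    (hcont : PiecewiseHarmonic.IsContinuousIn U Ψ) :
    PiecewiseHarmonic.distDz
        (PiecewiseHarmonic.regularDistribution U (fun z => (Ψ z : ℂ))) =
      PiecewiseHarmonic.regularDistribution U (fun z => ∑ i,
        (PiecewiseHarmonic.canonicalPiece U Ψ (H i)).indicator
          (PiecewiseHarmonic.dz (H i)) z) ∧
    PiecewiseHarmonic.IsPiecewiseIn U (PiecewiseHarmonic.analyticFunctions U)
      (fun z => ∑ i,
        (PiecewiseHarmonic.canonicalPiece U Ψ (H i)).indicator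
          (PiecewiseHarmonic.dz (H i)) z) := by
  obtain ⟨c, hc, hΨc⟩ := hcont
  have hHc : ∀ i, ContinuousOn (H i) U := fun i z hz =>
    (contDiffAt_of_mem_harmonicFunctions (hΨ.mem i) hz).continuousAt.continuousWithinAt
  have hcH : ∀ i, Set.EqOn c (H i) (canonicalPiece U Ψ (H i)) := fun i =>
    eqOn_canonicalPiece hΨ.locallyIntegrableOn hc hΨc (hHc i)
  have hdisj := pairwise_disjoint_canonicalPiece hU hΨ.mem hΨ.distinct hcH
  have hnull : MeasureTheory.volume ((U : Set ℂ) \ ⋃ i, canonicalPiece U Ψ (H i)) = 0 := by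
    rw [diff_iUnion_canonicalPiece]
    exact hΨ.negligible
  have hΦ : MeasureTheory.LocallyIntegrableOn
      (fun z => ∑ i, (canonicalPiece U Ψ (H i)).indicator (dz (H i)) z) U
      MeasureTheory.volume :=
    locallyIntegrableOn_sum_indicator U.isOpen.measurableSet
      (fun i => isOpen_canonicalPiece.measurableSet)
      fun i => (analyticOnNhd_dz (hΨ.mem i)).continuousOn
  refine ⟨?_, isPiecewiseIn_of_eqOn (fun a => indicator_mem_analyticFunctions) hΦ
    (fun i => analyticOnNhd_dz (hΨ.mem i)) (fun i => isOpen_canonicalPiece)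
    (fun i => canonicalPiece_subset)
    (fun i z hz => sum_indicator_eq_of_mem hdisj (fun j => dz (H j)) hz) hnull⟩
  -- With no pieces, the nonempty open set U would be null.
  have : Nonempty (Fin r) := by
    obtain ⟨z, hz⟩ := hU.nonempty
    obtain ⟨i, -⟩ := exists_eq_of_measure_diff_iUnion_eq_zero U.isOpen hc hHc hcH hnull hz
    exact ⟨i⟩
  ext u
  have hparts := integral_lineDeriv_mul_eq_neg_of_piecewise U.isOpen
    (fun i => isOpen_canonicalPiece) hdisj hc
    (fun i z hz => contDiffAt_of_mem_harmonicFunctions (hΨ.mem i) hz) hcH hnull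
    (u.contDiff.of_le (by simp)) u.hasCompactSupport u.tsupport_subset
  have hint : ∀ v : ℂ, MeasureTheory.Integrable fun z => u z * ∑ i,
      (canonicalPiece U Ψ (H i)).indicator (fun y => fderiv ℝ (H i) y v) z := fun v =>
    integrable_smul_of_tsupport_subset u.continuous u.hasCompactSupport u.tsupport_subset
      (locallyIntegrableOn_sum_indicator U.isOpen.measurableSet
        (fun i => isOpen_canonicalPiece.measurableSet)
        fun i z hz => (((contDiffAt_of_mem_harmonicFunctions (hΨ.mem i) hz).fderiv_right
          (m := 0) le_rfl).continuousAt.clm_apply continuousAt_const).continuousWithinAt)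
  have hleft : distDz (regularDistribution U fun z => (Ψ z : ℂ)) u = (1 / 2 : ℂ) *
      ((∂_{(1 : ℂ)} (regularDistribution U fun z => (Ψ z : ℂ))) u -
        Complex.I * (∂_{Complex.I} (regularDistribution U fun z => (Ψ z : ℂ))) u) := rfl
  rw [hleft, lineDerivOp_regularDistribution_ofReal hΨ.locallyIntegrableOn hΨc,
    lineDerivOp_regularDistribution_ofReal hΨ.locallyIntegrableOn hΨc, hparts, hparts,
    regularDistribution_apply hΦ]
  simp only [Complex.ofReal_neg, neg_neg]
  rw [← integral_complex_ofReal, ← integral_complex_ofReal, ← MeasureTheory.integral_const_mul,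
    ← MeasureTheory.integral_sub (hint 1).ofReal ((hint Complex.I).ofReal.const_mul _),
    ← MeasureTheory.integral_const_mul]
  refine MeasureTheory.integral_congr_ae (Filter.Eventually.of_forall fun z => ?_)
  have hdz : ∀ i, (canonicalPiece U Ψ (H i)).indicator (dz (H i)) z = (1 / 2 : ℂ) *
      (((canonicalPiece U Ψ (H i)).indicator (fun y => fderiv ℝ (H i) y 1) z : ℝ) - Complex.I *
        ((canonicalPiece U Ψ (H i)).indicator (fun y => fderiv ℝ (H i) y Complex.I) z : ℝ)) := by
    intro i
    by_cases hz : z ∈ canonicalPiece U Ψ (H i) <;> simp [hz, dz]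
  simp only [hdz, ← Finset.mul_sum, Finset.sum_sub_distrib, Complex.ofReal_mul,
    Complex.ofReal_sum, Complex.real_smul]
  ring
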